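/- \textbf{Theorem (Empirical approximation under smoothed $\mathsf W_1$).} For Borel probability measures $\mu,\nu$ on $\mathbb R^d$ let $\mathsf W_1(\mu,\nu)=\inf_\pi\int\|x-y\|\,d\pi(x,y)$, the infimum being over all couplings $\pi$ of $\mu$ and $\nu$ and $\|\cdot\|$ the Euclidean norm. A probability measure $\mu$ on $\mathbb R^d$ with finite first moment is called $K$-subgaussian, $K>0$, if $X\sim\mu$ satisfies $\mathbb E\,e^{\alpha^\top(X-\mathbb EX)}\le e^{K^2\|\alpha\|^2/2}$ for all $\alpha\in\mathbb R^d$. For $X_1,\dots,X_n$ i.i.d. with law $\mu$ put $\hat\mu_n=\frac1n\sum_{i=1}^n\delta_{X_i}$. (a) Let $\sigma>0$ and $M\in\mathbb R$. There is a constant $c_1>0$, depending only on $\sigma$ and $M$, such that the following holds for every probability density $\tilde g:\mathbb R\to[0,\infty)$ that is $\sigma$-subgaussian (i.e. $\tilde g(t)\,dt$ is a $\sigma$-subgaussian measure), satisfies $\tilde g\le M$, is non-increasing on $[0,\infty)$ and is non-decreasing on $(-\infty,0]$. First, with $\delta=\min\{1,\frac1{4\sigma^2}\}$, for every $d$ and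 every $t\in\mathbb R^d$, $$\prod_{j=1}^d\tilde g(t_j)\le c_1^d\,e^{\delta\|t\|^2}\,(2\pi\sigma^2)^{-d/2}e^{-\|t\|^2/(2\sigma^2)} .$$ Second, for every $d\ge1$, $K>0$ and $n\ge1$ and every $K$-subgaussian $\mu$ on $\mathbb R^d$, if $\mathcal G_\sigma$ is the probability measure on $\mathbb R^d$ with density $\prod_{j=1}^d\tilde g(x_j)$, then $\mathsf W_1(\hat\mu_n*\mathcal G_\sigma,\mu*\mathcal G_\sigma)$ is a measurable function of the sample (up to null sets) and $$\mathbb E\,\mathsf W_1(\hat\mu_n*\mathcal G_\sigma,\ \mu*\mathcal G_\sigma)\le c_1^d\,\sigma\sqrt{2d}\,\Big(1+\frac K\sigma\Big)^{\frac d2+1}e^{\frac{3d}{16}}\;n^{-1/2}.$$ In particular, for a fixed factor $\tilde g$ and fixed $K$, the constant in front of $n^{-1/2}$ is $e^{O(d)}$. (b) In particular, let $\mathcal N_\sigma=\mathcal N(0,\sigma^2\mathrm I_d)$. For all $d\ge1$, $\sigma>0$ and $K>0$ there is a constant $C$ such that for every $K$-subgaussian $\mu$ on $\mathbb R^d$ and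 every $n\ge1$, $\mathsf W_1(\hat\mu_n*\mathcal N_\sigma,\mu*\mathcal N_\sigma)$ is a measurable function of the sample (up to null sets) and $$\mathbb E\,\mathsf W_1(\hat\mu_n*\mathcal N_\sigma,\ \mu*\mathcal N_\sigma)\le C\,n^{-1/2}.$$ -/

import Mathlib

open MeasureTheory ProbabilityTheory
open scoped ENNReal

noncomputable section

namespace GOT

/-- The set of couplings (transport plans) between two measures. -/
def couplings {E : Type*} [MeasurableSpace E] (μ ν : Measure E) : Set (Measure (E × E)) :=
  {π | π.map Prod.fst = μ ∧ π.map Prod.snd = ν}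

/-- The 1-Wasserstein distance, with values in `[0, ∞]`: the infimum of the transport cost
`∫ ‖x - y‖ dπ(x, y)` over all couplings `π`. -/
def W1 {E : Type*} [MeasurableSpace E] [PseudoEMetricSpace E] (μ ν : Measure E) : ℝ≥0∞ :=
  ⨅ π ∈ couplings μ ν, ∫⁻ p, edist p.1 p.2 ∂π

/-- The 1-Wasserstein distance after smoothing both measures by convolution with `G`. -/
def smoothW1 {E : Type*} [MeasurableSpace E] [PseudoEMetricSpace E] [AddMonoid E]
    (G μ ν : Measure E) : ℝ≥0∞ :=
  W1 (Measure.conv μ G) (Measure.conv ν G)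

/-- The empirical measure `(1/n) ∑ δ_{x i}` of a sample of size `n` (for `n ≥ 1`). -/
def empirical {E : Type*} [MeasurableSpace E] {n : ℕ} (x : Fin n → E) : Measure E :=
  (n : ℝ≥0∞)⁻¹ • ∑ i, Measure.dirac (x i)

/-- `K`-subgaussian probability measures with finite first moment, on a Euclidean space. -/
structure IsSubgaussian {E : Type*} [NormedAddCommGroup E] [InnerProductSpace ℝ E]
    [MeasurableSpace E] (K : ℝ) (μ : Measure E) : Prop where
  isProbabilityMeasure : IsProbabilityMeasure μ
  integrable_id : Integrable (fun x : E => x) μ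
  integrable_exp : ∀ a : E, Integrable (fun x : E => Real.exp (inner ℝ a (x - ∫ y, y ∂μ))) μ
  integral_exp_le : ∀ a : E,
    ∫ x, Real.exp (inner ℝ a (x - ∫ y, y ∂μ)) ∂μ ≤ Real.exp (K ^ 2 * ‖a‖ ^ 2 / 2)

/-- `g` is the density of a `σ`-subgaussian probability measure on the line, it is bounded by `M`,
and it decreases (not necessarily strictly) as its argument goes away from zero in either
direction. -/
structure IsNoiseDensity (σ M : ℝ) (g : ℝ → ℝ) : Prop where
  nonneg : ∀ t, 0 ≤ g t
  subgaussian : IsSubgaussian σ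
    ((volume : Measure ℝ).withDensity fun t => ENNReal.ofReal (g t))
  le_bound : ∀ t, g t ≤ M
  antitoneOn : AntitoneOn g (Set.Ici 0)
  monotoneOn : MonotoneOn g (Set.Iic 0)

/-- The product density on `ℝ^d` with one-dimensional factor `g`. -/
def prodDensity (d : ℕ) (g : ℝ → ℝ) (x : EuclideanSpace ℝ (Fin d)) : ℝ :=
  ∏ j, g (x j)

/-- The noise distribution on `ℝ^d` whose density is the product density with factor `g`. -/
def noise (d : ℕ) (g : ℝ → ℝ) : Measure (EuclideanSpace ℝ (Fin d)) :=
  (volume : Measure (EuclideanSpace ℝ (Fin d))).withDensity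
    fun x => ENNReal.ofReal (prodDensity d g x)

/-- The isotropic Gaussian measure `N(0, σ² I_d)`. -/
def isoGaussian (d : ℕ) (σ : ℝ) : Measure (EuclideanSpace ℝ (Fin d)) :=
  multivariateGaussian 0 (σ ^ 2 • (1 : Matrix (Fin d) (Fin d) ℝ))

/-- The density of the isotropic Gaussian measure `N(0, σ² I_d)`. -/
def gaussianDensity (d : ℕ) (σ : ℝ) (x : EuclideanSpace ℝ (Fin d)) : ℝ :=
  (2 * Real.pi * σ ^ 2) ^ (-(d : ℝ) / 2) * Real.exp (-‖x‖ ^ 2 / (2 * σ ^ 2))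

/-- The constant `c₁^d σ √(2d) (1 + K/σ)^{d/2 + 1} e^{3d/16}`. -/
def rateConst (c₁ σ : ℝ) (d : ℕ) (K : ℝ) : ℝ :=
  c₁ ^ d * σ * √(2 * d) * (1 + K / σ) ^ ((d : ℝ) / 2 + 1) * Real.exp (3 * d / 16)

end GOT

end

/-! Smoothing turns both measures into measures with densities, and transport is then controlled by
a weighted total variation: `W1_withDensity_le` leaves the common mass in place and sends the excess
through a fixed point `m`, so that W₁ ≤ ∫ ‖z - m‖ |p(z) - q(z)| dz. For fixed z, the difference p(z)
- q(z) is a centred average of n i.i.d. bounded variables f(z - Xᵢ), so its mean absolute value is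
at most n^{-1/2} (E f(z - X)²)^{1/2}. This gives the rate n^{-1/2} in every dimension, provided that
∫ ‖z - m‖ (E f(z - X)²)^{1/2} dz is finite.

For `m` the mean of μ, Cauchy–Schwarz with a Gaussian weight of scale K + σ bounds that integral. It
needs two inputs: Gaussian decay of f², and the exponential square moment of a subgaussian law
(`IsSubgaussian.lintegral_exp_sq_norm_le`).

The decay comes from unimodality: g(t) is at most the mass of the unit interval ending at t, to
which Chernoff's bound applies. Chernoff's bound is centred at the mean of g, and the constant may
depend only on σ and M; `IsNoiseDensity.integral_le` therefore bounds the mean in terms of σ alone.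
Gaussian noise is a special case of the general noise. -/

namespace GOT

/-! ### Couplings: the triangle inequality and the weighted total variation bound -/

section Transport

variable {E : Type*} [MeasurableSpace E]

/-- Two transport plans with a common middle marginal can be glued. -/
lemma exists_gluing [StandardBorelSpace E] {μ ν τ : Measure E} [IsFiniteMeasure ν]
    {ρ π : Measure (E × E)} (hρ : ρ ∈ couplings μ ν) (hπ : π ∈ couplings ν τ) :
    ∃ γ : Measure ((E × E) × E), γ.map Prod.fst = ρ ∧
      γ.map (fun q => (q.1.2, q.2)) = π := by
  obtain ⟨hρ1, hρ2⟩ := hρ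
  obtain ⟨hπ1, hπ2⟩ := hπ
  have hfρ : IsFiniteMeasure ρ := by
    constructor
    rw [← Set.preimage_univ (f := (Prod.snd : E × E → E)), ← Measure.map_apply measurable_snd .univ,
      hρ2]
    exact measure_lt_top _ _
  have hfπ : IsFiniteMeasure π := by
    constructor
    rw [← Set.preimage_univ (f := (Prod.fst : E × E → E)), ← Measure.map_apply measurable_fst .univ,
      hπ1]
    exact measure_lt_top _ _
  -- The conditional kernel needs a nonempty space; on an empty one every measure is zero.
  rcases isEmpty_or_nonempty E with hE | hE
  · exact ⟨0, by simp [Measure.eq_zero_of_isEmpty ρ], by simp [Measure.eq_zero_of_isEmpty π]⟩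
  obtain ⟨κ, hκ, hdis⟩ : ∃ κ : Kernel E E, IsMarkovKernel κ ∧ ν ⊗ₘ κ = π :=
    ⟨π.condKernel, inferInstance, by rw [← hπ1]; exact π.disintegrate π.condKernel⟩
  -- Given a pair drawn from `ρ`, the third point is drawn from the conditional law of `π` at the
  -- middle point, independently of the first.
  refine ⟨ρ ⊗ₘ (κ.comap Prod.snd measurable_snd), Measure.fst_compProd _ _, ?_⟩
  refine Measure.ext_of_lintegral _ fun f hf => ?_
  rw [lintegral_map hf (by fun_prop), Measure.lintegral_compProd (by fun_prop), ← hdis,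
    Measure.lintegral_compProd (by fun_prop), ← hρ2]
  have hm : Measurable fun a => ∫⁻ b, f (a, b) ∂κ a :=
    Measurable.lintegral_kernel_prod_right' (f := f) hf
  rw [lintegral_map hm measurable_snd]
  simp [Kernel.comap_apply]

variable [PseudoEMetricSpace E]

lemma W1_le_of_mem_couplings {μ ν : Measure E} {π : Measure (E × E)} (hπ : π ∈ couplings μ ν) :
    W1 μ ν ≤ ∫⁻ p, edist p.1 p.2 ∂π :=
  iInf₂_le π hπ

/-- The triangle inequality for the Wasserstein distance. -/
lemma W1_triangle [StandardBorelSpace E] [OpensMeasurableSpace E] [SecondCountableTopology E]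
    (μ ν τ : Measure E) [IsFiniteMeasure ν] : W1 μ τ ≤ W1 μ ν + W1 ν τ := by
  refine ENNReal.le_iInf₂_add_iInf₂ fun ρ hρ π hπ => ?_
  obtain ⟨γ, hγ1, hγ2⟩ := exists_gluing hρ hπ
  have hmem : γ.map (fun q => (q.1.1, q.2)) ∈ couplings μ τ := by
    constructor
    · rw [Measure.map_map measurable_fst (by fun_prop), ← hρ.1, ← hγ1,
        Measure.map_map measurable_fst measurable_fst]
      rfl
    · rw [Measure.map_map measurable_snd (by fun_prop), ← hπ.2, ← hγ2,
        Measure.map_map measurable_snd (by fun_prop)]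
      rfl
  refine (W1_le_of_mem_couplings hmem).trans ?_
  rw [← hγ1, ← hγ2, lintegral_map (by fun_prop) (by fun_prop),
    lintegral_map (by fun_prop) (by fun_prop), lintegral_map (by fun_prop) (by fun_prop),
    ← lintegral_add_left (by fun_prop)]
  exact lintegral_mono fun q => edist_triangle _ _ _

/-- The Wasserstein distance is at most a weighted total variation distance. -/
lemma W1_withDensity_le [OpensMeasurableSpace E] [SecondCountableTopology E] {lam : Measure E}
    [SFinite lam] {p q : E → ℝ≥0∞} (hp : Measurable p) (hq : Measurable q)
    (hp1 : ∫⁻ x, p x ∂lam = 1) (hq1 : ∫⁻ x, q x ∂lam = 1) (m : E) :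
    W1 (lam.withDensity p) (lam.withDensity q) ≤
      ∫⁻ x, edist x m * ((p x - q x) + (q x - p x)) ∂lam := by
  set P := lam.withDensity (fun x => p x - q x) with hP
  set Q := lam.withDensity (fun x => q x - p x) with hQ
  set D := lam.withDensity (fun x => min (p x) (q x)) with hD
  set c := P Set.univ with hc
  have hmin1 : ∫⁻ x, min (p x) (q x) ∂lam ≠ ∞ :=
    ((lintegral_mono fun x => min_le_left (p x) (q x)).trans_lt (hp1 ▸ ENNReal.one_lt_top)).ne
  have hDP : D + P = lam.withDensity p := by
    rw [hD, hP, ← withDensity_add_left (by fun_prop)]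
    congr 1; ext x
    simp only [Pi.add_apply]
    rcases le_total (p x) (q x) with h | h
    · rw [min_eq_left h, tsub_eq_zero_of_le h, add_zero]
    · rw [min_eq_right h, add_tsub_cancel_of_le h]
  have hDQ : D + Q = lam.withDensity q := by
    rw [hD, hQ, ← withDensity_add_left (by fun_prop)]
    congr 1; ext x
    simp only [Pi.add_apply]
    rcases le_total (p x) (q x) with h | h
    · rw [min_eq_left h, add_tsub_cancel_of_le h]
    · rw [min_eq_right h, tsub_eq_zero_of_le h, add_zero]
  have hDfin : D Set.univ ≠ ∞ := by
    rw [hD, withDensity_apply _ .univ, Measure.restrict_univ]; exact hmin1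
  have h1 : D Set.univ + P Set.univ = 1 := by
    rw [← Measure.add_apply, hDP, withDensity_apply _ .univ, Measure.restrict_univ, hp1]
  have h2 : D Set.univ + Q Set.univ = 1 := by
    rw [← Measure.add_apply, hDQ, withDensity_apply _ .univ, Measure.restrict_univ, hq1]
  have hcQ : Q Set.univ = c := (ENNReal.add_right_inj hDfin).1 (h2.trans h1.symm)
  have hctop : c ≠ ∞ := fun h => by rw [← hc, h] at h1; simp at h1
  have hPf : IsFiniteMeasure P := ⟨hctop.lt_top⟩
  have hQf : IsFiniteMeasure Q := ⟨hcQ ▸ hctop.lt_top⟩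
  -- Stated with the factor `c⁻¹ * c` to cover `c = 0` as well: there `c⁻¹ = ∞`, but `P` and `Q`
  -- vanish.
  have hcP : (c⁻¹ * c) • P = P := by
    by_cases h0 : c = 0
    · rw [Measure.measure_univ_eq_zero.1 (hc.symm.trans h0)]; simp
    · rw [ENNReal.inv_mul_cancel h0 hctop, one_smul]
  have hcQ' : (c⁻¹ * c) • Q = Q := by
    by_cases h0 : c = 0
    · rw [Measure.measure_univ_eq_zero.1 (hcQ.trans h0)]; simp
    · rw [ENNReal.inv_mul_cancel h0 hctop, one_smul]
  -- The common part `D` stays on the diagonal at no cost; the excesses `P` and `Q`, of equal mass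
  -- `c`, are coupled independently.
  have hmem : D.map (fun x => (x, x)) + c⁻¹ • P.prod Q ∈
      couplings (lam.withDensity p) (lam.withDensity q) := by
    constructor
    · rw [Measure.map_add _ _ measurable_fst, Measure.map_map measurable_fst (by fun_prop),
        Measure.map_smul, Measure.map_fst_prod, hcQ, smul_smul, hcP, ← hDP]
      congr 1
      exact Measure.map_id
    · rw [Measure.map_add _ _ measurable_snd, Measure.map_map measurable_snd (by fun_prop),
        Measure.map_smul, Measure.map_snd_prod, ← hc, smul_smul, hcQ', ← hDQ]
      congr 1
      exact Measure.map_id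
  refine (W1_le_of_mem_couplings hmem).trans ?_
  rw [lintegral_add_measure, lintegral_map (by fun_prop) (by fun_prop), lintegral_smul_measure]
  simp only [edist_self, lintegral_zero, zero_add]
  calc c⁻¹ • ∫⁻ z, edist z.1 z.2 ∂(P.prod Q)
      ≤ c⁻¹ • ∫⁻ z, (edist z.1 m + edist z.2 m) ∂(P.prod Q) := by
        gcongr with z; exact edist_triangle_right _ _ _
    _ = (c⁻¹ * c) * ∫⁻ x, edist x m ∂P + (c⁻¹ * c) * ∫⁻ x, edist x m ∂Q := by
        rw [lintegral_add_left (by fun_prop), lintegral_prod _ (by fun_prop),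
          lintegral_prod _ (by fun_prop)]
        simp only [lintegral_const, hcQ, ← hc]
        rw [lintegral_mul_const _ (by fun_prop), smul_eq_mul]
        ring
    _ = ∫⁻ x, edist x m ∂P + ∫⁻ x, edist x m ∂Q := by
        rw [← smul_eq_mul (c⁻¹ * c), ← smul_eq_mul (c⁻¹ * c), ← lintegral_smul_measure,
          ← lintegral_smul_measure, hcP, hcQ']
    _ = ∫⁻ x, edist x m * ((p x - q x) + (q x - p x)) ∂lam := by
        rw [hP, hQ, lintegral_withDensity_eq_lintegral_mul _ (by fun_prop) (by fun_prop),
          lintegral_withDensity_eq_lintegral_mul _ (by fun_prop) (by fun_prop),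
          ← lintegral_add_left (by fun_prop)]
        congr 1; ext x
        simp only [Pi.mul_apply]; ring

end Transport

/-! ### Integration against the empirical measure -/

section Empirical

variable {E : Type*} [MeasurableSpace E]

instance isProbabilityMeasure_empirical {n : ℕ} (x : Fin n → E) [NeZero n] :
    IsProbabilityMeasure (empirical x) := by
  constructor
  simp [empirical, ENNReal.inv_mul_cancel, NeZero.ne n]

lemma lintegral_empirical {n : ℕ} (x : Fin n → E) {f : E → ℝ≥0∞} (hf : Measurable f) :
    ∫⁻ y, f y ∂(empirical x) = (n : ℝ≥0∞)⁻¹ * ∑ i, f (x i) := by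
  simp [empirical, lintegral_smul_measure, lintegral_dirac' _ hf]

lemma empirical_conv [AddMonoid E] [MeasurableAdd₂ E] {n : ℕ} (x : Fin n → E)
    (G : Measure E) [SFinite G] :
    Measure.conv (empirical x) G = (n : ℝ≥0∞)⁻¹ • ∑ i, G.map (fun z => x i + z) := by
  refine Measure.ext_of_lintegral _ fun f hf => ?_
  rw [Measure.lintegral_conv hf, lintegral_smul_measure, lintegral_finsetSum_measure,
    lintegral_empirical x (f := fun y => ∫⁻ z, f (y + z) ∂G) (by fun_prop), smul_eq_mul]
  congr 2; ext i
  rw [lintegral_map hf (by fun_prop)]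

end Empirical

/-! ### Continuity of the smoothed distance in the sample -/

section Measurability

variable {E : Type*} [NormedAddCommGroup E] [MeasurableSpace E] [BorelSpace E]
  [SecondCountableTopology E]

/-- Couple by using the same index and the same noise on both sides: the noise cancels in the
distance, leaving the average of the distances between `x i` and `y i`. -/
lemma W1_empirical_conv_le {n : ℕ} [NeZero n] (x y : Fin n → E) (G : Measure E)
    [IsProbabilityMeasure G] :
    W1 (Measure.conv (empirical x) G) (Measure.conv (empirical y) G) ≤ edist x y := by
  have hmem : (n : ℝ≥0∞)⁻¹ • ∑ i, G.map (fun z => (x i + z, y i + z)) ∈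
      couplings (Measure.conv (empirical x) G) (Measure.conv (empirical y) G) := by
    constructor
    · rw [empirical_conv, Measure.map_smul, Measure.map_finset_sum measurable_fst.aemeasurable]
      congr 2; ext1 i
      rw [Measure.map_map measurable_fst (by fun_prop)]; rfl
    · rw [empirical_conv, Measure.map_smul, Measure.map_finset_sum measurable_snd.aemeasurable]
      congr 2; ext1 i
      rw [Measure.map_map measurable_snd (by fun_prop)]; rfl
  refine (W1_le_of_mem_couplings hmem).trans ?_
  rw [lintegral_smul_measure, lintegral_finsetSum_measure]
  calc (n : ℝ≥0∞)⁻¹ • ∑ i, ∫⁻ p, edist p.1 p.2 ∂(G.map (fun z => (x i + z, y i + z)))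
      ≤ (n : ℝ≥0∞)⁻¹ • ∑ i : Fin n, edist x y := by
        gcongr with i
        rw [lintegral_map (by fun_prop) (by fun_prop)]
        simp only [edist_add_right, lintegral_const, measure_univ, mul_one]
        exact edist_le_pi_edist x y i
    _ = edist x y := by
        simp [← mul_assoc, ENNReal.inv_mul_cancel, NeZero.ne n]

/-- The smoothed distance of the empirical measure to a fixed measure depends continuously on the
sample. -/
lemma continuous_smoothW1_empirical [CompleteSpace E] {n : ℕ} [NeZero n] (G μ : Measure E)
    [IsProbabilityMeasure G] :
    Continuous fun x : Fin n → E => smoothW1 G (empirical x) μ := by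
  -- A one-sided Lipschitz bound with values in `[0, ∞]`, so finiteness of the distance is not
  -- needed.
  refine continuous_of_le_add_edist 1 ENNReal.one_ne_top fun x y => ?_
  have := W1_triangle (Measure.conv (empirical x) G) (Measure.conv (empirical y) G)
    (Measure.conv μ G)
  rw [one_mul, add_comm]
  exact this.trans (by gcongr; exacts [W1_empirical_conv_le x y G, le_rfl])

end Measurability
-- Reduction to second moments of the translated density
section ExpectedDistance

lemma conv_withDensity {E : Type*} [NormedAddCommGroup E] [MeasurableSpace E] [BorelSpace E]
    [SecondCountableTopology E] (lam : Measure E) [SFinite lam] [lam.IsAddLeftInvariant]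
    (μ : Measure E) [SFinite μ] {f : E → ℝ≥0∞} (hf : Measurable f) :
    Measure.conv μ (lam.withDensity f) = lam.withDensity fun z => ∫⁻ y, f (z - y) ∂μ := by
  have hm : Measurable fun z => ∫⁻ y, f (z - y) ∂μ :=
    Measurable.lintegral_prod_right' (f := fun p : E × E => f (p.1 - p.2)) (by fun_prop)
  refine Measure.ext_of_lintegral _ fun h hh => ?_
  rw [Measure.lintegral_conv hh, lintegral_withDensity_eq_lintegral_mul _ hm hh]
  calc ∫⁻ y, ∫⁻ t, h (y + t) ∂(lam.withDensity f) ∂μ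
      = ∫⁻ y, ∫⁻ z, f (z - y) * h z ∂lam ∂μ := by
        congr 1; ext y
        rw [lintegral_withDensity_eq_lintegral_mul _ hf (by fun_prop),
          ← lintegral_add_left_eq_self (fun z => f (z - y) * h z) y]
        simp
    _ = ∫⁻ z, ∫⁻ y, f (z - y) * h z ∂μ ∂lam := lintegral_lintegral_swap (by fun_prop)
    _ = ∫⁻ z, ((fun z => ∫⁻ y, f (z - y) ∂μ) * h) z ∂lam := by
        congr 1; ext z
        rw [lintegral_mul_const _ (by fun_prop)]; rfl

/-- This is nonnegativity of the variance of |Z|. -/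
lemma integral_abs_le_sqrt {Ω : Type*} [MeasurableSpace Ω] {P : Measure Ω} [IsProbabilityMeasure P]
    {Z : Ω → ℝ} (hZ : MemLp Z 2 P) : ∫ ω, |Z ω| ∂P ≤ √(∫ ω, Z ω ^ 2 ∂P) := by
  apply Real.le_sqrt_of_sq_le
  have h := variance_nonneg |Z| P
  rw [variance_eq_sub hZ.abs] at h
  simp only [Pi.pow_apply, Pi.abs_apply, sq_abs] at h
  linarith

/-- The mean absolute deviation of an empirical average of i.i.d. bounded variables. -/
lemma lintegral_abs_average_sub_le {E : Type*} [MeasurableSpace E] {μ : Measure E}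
    [IsProbabilityMeasure μ] {f : E → ℝ} (hf : Measurable f) {C : ℝ} (hC : ∀ y, |f y| ≤ C)
    {n : ℕ} (hn : 1 ≤ n) :
    ∫⁻ x : Fin n → E, ENNReal.ofReal |(n : ℝ)⁻¹ * ∑ i, f (x i) - ∫ y, f y ∂μ|
        ∂(Measure.pi fun _ => μ) ≤
      ENNReal.ofReal ((n : ℝ) ^ (-(1 / 2 : ℝ)) * √(∫ y, f y ^ 2 ∂μ)) := by
  have hn0 : (0 : ℝ) < n := by exact_mod_cast hn
  have hL : MemLp f 2 μ := MemLp.of_bound hf.aestronglyMeasurable C (ae_of_all _ hC)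
  have hLi (i : Fin n) : MemLp (fun x : Fin n → E => f (x i)) 2 (Measure.pi fun _ => μ) :=
    hL.comp_measurePreserving (measurePreserving_eval (fun _ : Fin n => μ) i)
  have hint (i : Fin n) : ∫ x : Fin n → E, f (x i) ∂(Measure.pi fun _ => μ) = ∫ y, f y ∂μ := by
    have h := (measurePreserving_eval (fun _ : Fin n => μ) i).map_eq
    conv_rhs => rw [← h]
    rw [integral_map (measurable_pi_apply i).aemeasurable hf.aestronglyMeasurable]
  have hS : MemLp (∑ i, fun x : Fin n → E => f (x i)) 2 (Measure.pi fun _ => μ) :=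
    memLp_finsetSum' _ fun i _ => hLi i
  have hY : MemLp (fun x : Fin n → E => (n : ℝ)⁻¹ * (∑ i, fun x : Fin n → E => f (x i)) x) 2
      (Measure.pi fun _ => μ) := hS.const_mul _
  have hEY : ∫ x : Fin n → E, (n : ℝ)⁻¹ * (∑ i, fun x : Fin n → E => f (x i)) x
      ∂(Measure.pi fun _ => μ) = ∫ y, f y ∂μ := by
    rw [integral_const_mul]
    simp only [Finset.sum_apply]
    rw [integral_finsetSum _ fun i _ => (hLi i).integrable one_le_two]
    simp [hint, inv_mul_cancel_left₀ hn0.ne']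
  -- Independence enters here: variances add, so averaging divides the variance by `n`.
  have hVar : Var[fun x : Fin n → E => (n : ℝ)⁻¹ * (∑ i, fun x : Fin n → E => f (x i)) x;
      Measure.pi fun _ => μ] ≤ (n : ℝ)⁻¹ * ∫ y, f y ^ 2 ∂μ := by
    rw [variance_const_mul, variance_sum_pi (fun _ => hL)]
    have h1 : Var[f; μ] ≤ ∫ y, f y ^ 2 ∂μ := variance_le_expectation_sq hf.aestronglyMeasurable
    simp only [Finset.sum_const, Finset.card_univ, Fintype.card_fin, nsmul_eq_mul]
    calc ((n : ℝ)⁻¹) ^ 2 * (n * Var[f; μ]) = (n : ℝ)⁻¹ * Var[f; μ] := by field_simp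
      _ ≤ _ := by gcongr
  have hZ : MemLp (fun x : Fin n → E => (n : ℝ)⁻¹ * ∑ i, f (x i) - ∫ y, f y ∂μ) 2
      (Measure.pi fun _ => μ) := by
    have := hY.sub (memLp_const (∫ y, f y ∂μ))
    simp only [Finset.sum_apply] at this
    exact this
  have hZi := (hZ.integrable one_le_two).abs
  rw [← ofReal_integral_eq_lintegral_ofReal hZi (ae_of_all _ fun _ => abs_nonneg _)]
  apply ENNReal.ofReal_le_ofReal
  refine (integral_abs_le_sqrt hZ).trans ?_
  rw [variance_eq_integral hY.aestronglyMeasurable.aemeasurable, hEY] at hVar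
  simp only [Finset.sum_apply] at hVar
  refine (Real.sqrt_le_sqrt hVar).trans (le_of_eq ?_)
  rw [Real.sqrt_mul (by positivity), Real.sqrt_inv, Real.sqrt_eq_rpow, Real.rpow_neg hn0.le]

lemma tsub_add_tsub_ofReal {a b : ℝ} (ha : 0 ≤ a) (hb : 0 ≤ b) :
    (ENNReal.ofReal a - ENNReal.ofReal b) + (ENNReal.ofReal b - ENNReal.ofReal a) =
      ENNReal.ofReal |a - b| := by
  rw [← ENNReal.ofReal_sub _ hb, ← ENNReal.ofReal_sub _ ha]
  rcases le_total a b with h | h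
  · rw [ENNReal.ofReal_of_nonpos (sub_nonpos.2 h), zero_add, abs_of_nonpos (sub_nonpos.2 h),
      neg_sub]
  · rw [ENNReal.ofReal_of_nonpos (sub_nonpos.2 h), add_zero, abs_of_nonneg (sub_nonneg.2 h)]

variable {E : Type*} [NormedAddCommGroup E] [MeasurableSpace E] [BorelSpace E]
  [SecondCountableTopology E]

lemma lintegral_conv_density {lam μ : Measure E} [SFinite lam] [SFinite μ]
    [lam.IsAddLeftInvariant] [IsProbabilityMeasure μ] {f : E → ℝ≥0∞} (hf : Measurable f)
    (hG : IsProbabilityMeasure (lam.withDensity f)) :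
    ∫⁻ z, ∫⁻ y, f (z - y) ∂μ ∂lam = 1 := by
  have h : Measure.conv μ (lam.withDensity f) Set.univ = 1 := measure_univ
  rwa [conv_withDensity lam μ hf, withDensity_apply _ .univ, Measure.restrict_univ] at h

/-- The expected smoothed distance is bounded by a weighted integral of the second moments of the
translated noise densities. -/
lemma lintegral_smoothW1_empirical_le {lam μ : Measure E} [SFinite lam]
    [lam.IsAddLeftInvariant] [IsProbabilityMeasure μ] {f : E → ℝ} (hf : Measurable f)
    (hf0 : ∀ t, 0 ≤ f t) {C : ℝ} (hC : ∀ t, f t ≤ C)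
    (hG : IsProbabilityMeasure (lam.withDensity fun t => ENNReal.ofReal (f t)))
    (m : E) {n : ℕ} (hn : 1 ≤ n) :
    ∫⁻ x : Fin n → E, smoothW1 (lam.withDensity fun t => ENNReal.ofReal (f t)) (empirical x) μ
        ∂(Measure.pi fun _ => μ) ≤
      ENNReal.ofReal ((n : ℝ) ^ (-(1 / 2 : ℝ))) *
        ∫⁻ z, edist z m * ENNReal.ofReal (√(∫ y, f (z - y) ^ 2 ∂μ)) ∂lam := by
  have hn0 : (0 : ℝ) < n := by exact_mod_cast hn
  have : NeZero n := ⟨by omega⟩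
  have hF : Measurable fun t => ENNReal.ofReal (f t) := by fun_prop
  have hq (z : E) : ∫⁻ y, ENNReal.ofReal (f (z - y)) ∂μ = ENNReal.ofReal (∫ y, f (z - y) ∂μ) := by
    rw [ofReal_integral_eq_lintegral_ofReal _ (ae_of_all _ fun _ => hf0 _)]
    exact Integrable.of_bound (Measurable.aestronglyMeasurable (by fun_prop)) C
      (ae_of_all _ fun y => by rw [Real.norm_of_nonneg (hf0 _)]; exact hC _)
  have hp (x : Fin n → E) (z : E) : ∫⁻ y, ENNReal.ofReal (f (z - y)) ∂(empirical x) =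
      ENNReal.ofReal ((n : ℝ)⁻¹ * ∑ i, f (z - x i)) := by
    rw [lintegral_empirical x (f := fun y => ENNReal.ofReal (f (z - y))) (by fun_prop),
      ENNReal.ofReal_mul (by positivity), ENNReal.ofReal_sum_of_nonneg fun i _ => hf0 _,
      ENNReal.ofReal_inv_of_pos hn0, ENNReal.ofReal_natCast]
  have hqm : Measurable fun z => ∫⁻ y, ENNReal.ofReal (f (z - y)) ∂μ :=
    Measurable.lintegral_prod_right' (f := fun p : E × E => ENNReal.ofReal (f (p.1 - p.2)))
      (by fun_prop)
  have hpm (x : Fin n → E) :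
      Measurable fun z => ∫⁻ y, ENNReal.ofReal (f (z - y)) ∂(empirical x) :=
    Measurable.lintegral_prod_right' (f := fun p : E × E => ENNReal.ofReal (f (p.1 - p.2)))
      (by fun_prop)
  have hIm : Measurable fun z => ∫ y, f (z - y) ∂μ :=
    (StronglyMeasurable.integral_prod_right' (f := fun p : E × E => f (p.1 - p.2))
      (Measurable.stronglyMeasurable (by fun_prop))).measurable
  calc ∫⁻ x : Fin n → E, smoothW1 (lam.withDensity fun t => ENNReal.ofReal (f t)) (empirical x) μ
        ∂(Measure.pi fun _ => μ)
      ≤ ∫⁻ x : Fin n → E, ∫⁻ z, edist z m *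
          ENNReal.ofReal |(n : ℝ)⁻¹ * ∑ i, f (z - x i) - ∫ y, f (z - y) ∂μ| ∂lam
          ∂(Measure.pi fun _ => μ) := by
        refine lintegral_mono fun x => ?_
        rw [smoothW1, conv_withDensity lam _ hF, conv_withDensity lam _ hF]
        refine (W1_withDensity_le (hpm x) hqm (lintegral_conv_density hF hG)
          (lintegral_conv_density hF hG) m).trans (le_of_eq ?_)
        congr 1; ext z
        rw [hp, hq, tsub_add_tsub_ofReal (mul_nonneg (by positivity)
          (Finset.sum_nonneg fun i _ => hf0 _)) (integral_nonneg fun _ => hf0 _)]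
    -- Tonelli moves the expectation inside, where for fixed `z` it is the deviation of an i.i.d.
    -- average.
    _ = ∫⁻ z, ∫⁻ x : Fin n → E, edist z m *
          ENNReal.ofReal |(n : ℝ)⁻¹ * ∑ i, f (z - x i) - ∫ y, f (z - y) ∂μ|
          ∂(Measure.pi fun _ => μ) ∂lam := by
        refine lintegral_lintegral_swap (Measurable.aemeasurable ?_)
        have h1 : Measurable fun p : (Fin n → E) × E => ∫ y, f (p.2 - y) ∂μ :=
          hIm.comp measurable_snd
        simp only [Function.uncurry_def]
        fun_prop
    _ ≤ ∫⁻ z, edist z m * (ENNReal.ofReal ((n : ℝ) ^ (-(1 / 2 : ℝ))) *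
          ENNReal.ofReal (√(∫ y, f (z - y) ^ 2 ∂μ))) ∂lam := by
        refine lintegral_mono fun z => ?_
        simp only
        rw [lintegral_const_mul _ (by fun_prop), ← ENNReal.ofReal_mul (by positivity)]
        gcongr
        exact lintegral_abs_average_sub_le (f := fun y => f (z - y)) (by fun_prop) (C := C)
          (fun y => by rw [abs_of_nonneg (hf0 _)]; exact hC _) hn
    _ = _ := by
        have h2 : Measurable fun z => ∫ y, f (z - y) ^ 2 ∂μ :=
          (StronglyMeasurable.integral_prod_right' (f := fun p : E × E => f (p.1 - p.2) ^ 2)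
            (Measurable.stronglyMeasurable (by fun_prop))).measurable
        rw [← lintegral_const_mul _ (by fun_prop)]
        congr 1; ext z; ring

end ExpectedDistance
-- Gaussian integrals and the weighted Cauchy–Schwarz bound
section Core

variable {d : ℕ}

lemma lintegral_exp_neg_mul_sq_norm {b : ℝ} (hb : 0 < b) :
    ∫⁻ v : EuclideanSpace ℝ (Fin d), ENNReal.ofReal (Real.exp (-b * ‖v‖ ^ 2)) =
      ENNReal.ofReal ((Real.pi / b) ^ ((d : ℝ) / 2)) := by
  have h := GaussianFourier.integral_rexp_neg_mul_sq_norm (V := EuclideanSpace ℝ (Fin d)) hb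
  rw [finrank_euclideanSpace_fin] at h
  have hpos : 0 < (Real.pi / b) ^ ((d : ℝ) / 2) := by positivity
  rw [← h]
  exact (ofReal_integral_eq_lintegral_ofReal
    (Integrable.of_integral_ne_zero (by rw [h]; exact hpos.ne'))
    (ae_of_all _ fun _ => (Real.exp_pos _).le)).symm

/-- Completing the square in a Gaussian integral. -/
lemma lintegral_exp_neg_mul_sq_norm_add_inner {b : ℝ} (hb : 0 < b)
    (u : EuclideanSpace ℝ (Fin d)) :
    ∫⁻ v : EuclideanSpace ℝ (Fin d),
        ENNReal.ofReal (Real.exp (-b * ‖v‖ ^ 2)) * ENNReal.ofReal (Real.exp (inner ℝ v u)) =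
      ENNReal.ofReal ((Real.pi / b) ^ ((d : ℝ) / 2)) *
        ENNReal.ofReal (Real.exp (‖u‖ ^ 2 / (4 * b))) := by
  rw [← lintegral_exp_neg_mul_sq_norm hb, ← lintegral_mul_const _ (by fun_prop),
    ← lintegral_add_right_eq_self (fun v : EuclideanSpace ℝ (Fin d) =>
      ENNReal.ofReal (Real.exp (-b * ‖v‖ ^ 2)) * ENNReal.ofReal (Real.exp (inner ℝ v u)))
      ((2 * b)⁻¹ • u)]
  congr 1; ext v
  rw [← ENNReal.ofReal_mul (Real.exp_pos _).le, ← ENNReal.ofReal_mul (Real.exp_pos _).le,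
    ← Real.exp_add, ← Real.exp_add, norm_add_sq_real, inner_add_left, inner_smul_left,
    inner_smul_right, norm_smul, real_inner_self_eq_norm_sq]
  congr 2
  simp only [mul_pow, Real.norm_eq_abs, sq_abs, conj_trivial]
  field_simp
  ring

/-- Linearise the square: up to the factor (π/S²)^{d/2}, exp(‖u‖²/(4S²)) is the integral over v of
exp(-S²‖v‖² + ⟨v, u⟩). After swapping integrals the subgaussian bound costs at most exp(S²‖v‖²/2),
which leaves a Gaussian integral (2π/S²)^{d/2}; the ratio is 2^{d/2}. -/
lemma IsSubgaussian.lintegral_exp_sq_norm_le {K S : ℝ}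
    {μ : Measure (EuclideanSpace ℝ (Fin d))} (hμ : IsSubgaussian K μ) (hS : 0 < S)
    (hKS : K ^ 2 ≤ S ^ 2) :
    ∫⁻ y, ENNReal.ofReal (Real.exp (‖y - ∫ x, x ∂μ‖ ^ 2 / (4 * S ^ 2))) ∂μ ≤
      ENNReal.ofReal (2 ^ ((d : ℝ) / 2)) := by
  have := hμ.isProbabilityMeasure
  set m := ∫ x, x ∂μ with hm
  have hb : 0 < S ^ 2 := by positivity
  have hA : 0 < (Real.pi / S ^ 2) ^ ((d : ℝ) / 2) := by positivity
  have hmgf (v : EuclideanSpace ℝ (Fin d)) :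
      ∫⁻ y, ENNReal.ofReal (Real.exp (inner ℝ v (y - m))) ∂μ ≤
        ENNReal.ofReal (Real.exp (S ^ 2 * ‖v‖ ^ 2 / 2)) := by
    rw [← ofReal_integral_eq_lintegral_ofReal (hμ.integrable_exp v)
      (ae_of_all _ fun _ => (Real.exp_pos _).le)]
    refine ENNReal.ofReal_le_ofReal ((hμ.integral_exp_le v).trans ?_)
    gcongr
  have key : ENNReal.ofReal ((Real.pi / S ^ 2) ^ ((d : ℝ) / 2)) *
      ∫⁻ y, ENNReal.ofReal (Real.exp (‖y - m‖ ^ 2 / (4 * S ^ 2))) ∂μ ≤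
      ENNReal.ofReal ((Real.pi / S ^ 2) ^ ((d : ℝ) / 2)) * ENNReal.ofReal (2 ^ ((d : ℝ) / 2)) := by
    rw [← lintegral_const_mul _ (by fun_prop)]
    simp_rw [← lintegral_exp_neg_mul_sq_norm_add_inner hb]
    rw [lintegral_lintegral_swap (Measurable.aemeasurable (by fun_prop))]
    calc ∫⁻ v : EuclideanSpace ℝ (Fin d), ∫⁻ y, ENNReal.ofReal (Real.exp (-S ^ 2 * ‖v‖ ^ 2)) *
          ENNReal.ofReal (Real.exp (inner ℝ v (y - m))) ∂μ
        ≤ ∫⁻ v : EuclideanSpace ℝ (Fin d), ENNReal.ofReal (Real.exp (-(S ^ 2 / 2) * ‖v‖ ^ 2)) := by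
          refine lintegral_mono fun v => ?_
          simp only
          rw [lintegral_const_mul _ (by fun_prop)]
          refine (mul_le_mul_right (hmgf v) _).trans (le_of_eq ?_)
          rw [← ENNReal.ofReal_mul (Real.exp_pos _).le, ← Real.exp_add]
          congr 2; ring
      _ = _ := by
          rw [lintegral_exp_neg_mul_sq_norm (by positivity), ← ENNReal.ofReal_mul hA.le,
            ← Real.mul_rpow (by positivity) (by positivity)]
          congr 2; field_simp
  exact (ENNReal.mul_le_mul_iff_right (ENNReal.ofReal_pos.2 hA).ne' ENNReal.ofReal_ne_top).1 key

lemma lintegral_mul_le_sqrt_mul {Ω : Type*} [MeasurableSpace Ω] {P : Measure Ω}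
    {F H : Ω → ℝ≥0∞} (hF : Measurable F) (hH : Measurable H) {A B : ℝ} (hA : 0 ≤ A)
    (hB : 0 ≤ B) (hFA : ∫⁻ ω, F ω ^ 2 ∂P ≤ ENNReal.ofReal A)
    (hHB : ∫⁻ ω, H ω ^ 2 ∂P ≤ ENNReal.ofReal B) :
    ∫⁻ ω, F ω * H ω ∂P ≤ ENNReal.ofReal √(A * B) := by
  have h := ENNReal.lintegral_mul_le_Lp_mul_Lq P Real.HolderConjugate.two_two hF.aemeasurable
    hH.aemeasurable
  simp only [Pi.mul_apply, ENNReal.rpow_two] at h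
  refine h.trans ?_
  rw [← ENNReal.mul_rpow_of_nonneg _ _ (by norm_num), Real.sqrt_eq_rpow,
    ← ENNReal.ofReal_rpow_of_nonneg (mul_nonneg hA hB) (by norm_num), ENNReal.ofReal_mul hA]
  gcongr

/-- A Gaussian second moment bound. -/
lemma lintegral_sq_edist_mul_exp_le {a : ℝ} (ha : 0 < a) (m : EuclideanSpace ℝ (Fin d)) :
    ∫⁻ z, (edist z m * ENNReal.ofReal (Real.exp (-(a / 2) * ‖z - m‖ ^ 2))) ^ 2 ≤
      ENNReal.ofReal (2 / a * (2 * Real.pi / a) ^ ((d : ℝ) / 2)) := by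
  calc ∫⁻ z, (edist z m * ENNReal.ofReal (Real.exp (-(a / 2) * ‖z - m‖ ^ 2))) ^ 2
      ≤ ∫⁻ z, ENNReal.ofReal (2 / a) *
          ENNReal.ofReal (Real.exp (-(a / 2) * ‖z - m‖ ^ 2)) := by
        refine lintegral_mono fun z => ?_
        simp only
        rw [edist_dist, dist_eq_norm, ← ENNReal.ofReal_mul (norm_nonneg _),
          ← ENNReal.ofReal_pow (by positivity), ← ENNReal.ofReal_mul (by positivity)]
        apply ENNReal.ofReal_le_ofReal
        set r := ‖z - m‖ ^ 2 with hr
        -- The inequality x ≤ eˣ absorbs ‖z - m‖² into half of the squared Gaussian weight; the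
        -- other half remains to be integrated.
        have h1 : a / 2 * r ≤ Real.exp (a / 2 * r) := by
          linarith [Real.add_one_le_exp (a / 2 * r)]
        have h2 : Real.exp (a / 2 * r) * Real.exp (-(a / 2) * r) = 1 := by
          rw [← Real.exp_add]; simp
        have h3 : a / 2 * r * Real.exp (-(a / 2) * r) ≤ 1 := h2 ▸ by gcongr
        calc (‖z - m‖ * Real.exp (-(a / 2) * r)) ^ 2
            = 2 / a * (a / 2 * r * Real.exp (-(a / 2) * r)) * Real.exp (-(a / 2) * r) := by
              rw [mul_pow, ← hr]; field_simp
          _ ≤ 2 / a * 1 * Real.exp (-(a / 2) * r) := by gcongr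
          _ = _ := by ring
    _ = _ := by
        rw [lintegral_const_mul _ (by fun_prop),
          lintegral_sub_right_eq_self (fun z : EuclideanSpace ℝ (Fin d) =>
            ENNReal.ofReal (Real.exp (-(a / 2) * ‖z‖ ^ 2))) m,
          lintegral_exp_neg_mul_sq_norm (by positivity), ← ENNReal.ofReal_mul (by positivity)]
        congr 3; field_simp

/-- The weighted integral of the second moment of the noise density translated by a subgaussian
variable. -/
lemma lintegral_exp_mul_second_moment_le {f : EuclideanSpace ℝ (Fin d) → ℝ} (hf : Measurable f)
    {σ K B C : ℝ} (hσ : 0 < σ) (hK : 0 < K) (hB : 0 ≤ B) (hC : ∀ t, |f t| ≤ C)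
    (hfB : ∀ t, f t ^ 2 ≤ B * Real.exp (-‖t‖ ^ 2 / (2 * σ ^ 2)))
    {μ : Measure (EuclideanSpace ℝ (Fin d))} (hμ : IsSubgaussian K μ) :
    ∫⁻ z, (ENNReal.ofReal (Real.exp (1 / (8 * (K + σ) ^ 2) / 2 * ‖z - ∫ x, x ∂μ‖ ^ 2)) *
        ENNReal.ofReal √(∫ y, f (z - y) ^ 2 ∂μ)) ^ 2 ≤
      ENNReal.ofReal (B * (4 * Real.pi * σ ^ 2) ^ ((d : ℝ) / 2) * 2 ^ ((d : ℝ) / 2)) := by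
  have := hμ.isProbabilityMeasure
  set m := ∫ x, x ∂μ with hm
  set S := K + σ with hS
  have hS0 : 0 < S := by positivity
  have hC0 : 0 ≤ C := (abs_nonneg _).trans (hC 0)
  have hV (z : EuclideanSpace ℝ (Fin d)) :
      ENNReal.ofReal (∫ y, f (z - y) ^ 2 ∂μ) = ∫⁻ y, ENNReal.ofReal (f (z - y) ^ 2) ∂μ := by
    rw [ofReal_integral_eq_lintegral_ofReal _ (ae_of_all _ fun _ => sq_nonneg _)]
    refine Integrable.of_bound (Measurable.aestronglyMeasurable (by fun_prop)) (C ^ 2)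
      (ae_of_all _ fun y => ?_)
    rw [Real.norm_of_nonneg (sq_nonneg _), ← sq_abs]
    exact pow_le_pow_left₀ (abs_nonneg _) (hC _) 2
  calc ∫⁻ z, (ENNReal.ofReal (Real.exp (1 / (8 * S ^ 2) / 2 * ‖z - m‖ ^ 2)) *
        ENNReal.ofReal √(∫ y, f (z - y) ^ 2 ∂μ)) ^ 2
      = ∫⁻ z, ∫⁻ y, ENNReal.ofReal (Real.exp (1 / (8 * S ^ 2) * ‖z - m‖ ^ 2)) *
          ENNReal.ofReal (f (z - y) ^ 2) ∂μ := by
        congr 1; ext z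
        rw [lintegral_const_mul _ (by fun_prop), ← hV, mul_pow,
          ← ENNReal.ofReal_pow (Real.exp_pos _).le, ← ENNReal.ofReal_pow (Real.sqrt_nonneg _),
          Real.sq_sqrt (integral_nonneg fun _ => sq_nonneg _), ← Real.exp_nat_mul]
        congr 3; push_cast; ring
    _ ≤ ∫⁻ z, ∫⁻ y, ENNReal.ofReal B *
          (ENNReal.ofReal (Real.exp (-(1 / (4 * σ ^ 2)) * ‖z - y‖ ^ 2)) *
          ENNReal.ofReal (Real.exp (‖y - m‖ ^ 2 / (4 * S ^ 2)))) ∂μ := by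
        refine lintegral_mono fun z => lintegral_mono fun y => ?_
        simp only
        rw [← ENNReal.ofReal_mul (Real.exp_pos _).le, ← ENNReal.ofReal_mul (Real.exp_pos _).le,
          ← ENNReal.ofReal_mul hB, ← Real.exp_add]
        apply ENNReal.ofReal_le_ofReal
        refine (mul_le_mul_of_nonneg_left (hfB _) (Real.exp_pos _).le).trans ?_
        rw [mul_left_comm, ← Real.exp_add]
        refine mul_le_mul_of_nonneg_left (Real.exp_le_exp.2 ?_) hB
        -- This fixes the weight 1/(8S²): doubled, it uses at most half of the noise decay 1/(2σ²)
        -- in `z - y`, and exactly the rate 1/(4S²) of the exponential square moment in `y - m`.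
        have h1 : ‖z - m‖ ^ 2 ≤ 2 * ‖z - y‖ ^ 2 + 2 * ‖y - m‖ ^ 2 := by
          have h := norm_add_le (z - y) (y - m)
          rw [sub_add_sub_cancel] at h
          nlinarith [sq_nonneg (‖z - y‖ - ‖y - m‖), norm_nonneg (z - m)]
        have h2 : 1 / (4 * S ^ 2) ≤ 1 / (4 * σ ^ 2) := by
          gcongr; linarith
        calc 1 / (8 * S ^ 2) * ‖z - m‖ ^ 2 + -‖z - y‖ ^ 2 / (2 * σ ^ 2)
            ≤ 1 / (8 * S ^ 2) * (2 * ‖z - y‖ ^ 2 + 2 * ‖y - m‖ ^ 2)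
              + -‖z - y‖ ^ 2 / (2 * σ ^ 2) := by gcongr
          _ = 1 / (4 * S ^ 2) * ‖z - y‖ ^ 2 + -‖z - y‖ ^ 2 / (2 * σ ^ 2)
              + ‖y - m‖ ^ 2 / (4 * S ^ 2) := by field_simp; ring
          _ ≤ 1 / (4 * σ ^ 2) * ‖z - y‖ ^ 2 + -‖z - y‖ ^ 2 / (2 * σ ^ 2)
              + ‖y - m‖ ^ 2 / (4 * S ^ 2) := by gcongr
          _ = _ := by field_simp; ring
    _ = ∫⁻ y, ∫⁻ z, ENNReal.ofReal B *
          (ENNReal.ofReal (Real.exp (-(1 / (4 * σ ^ 2)) * ‖z - y‖ ^ 2)) *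
          ENNReal.ofReal (Real.exp (‖y - m‖ ^ 2 / (4 * S ^ 2)))) ∂volume ∂μ :=
        lintegral_lintegral_swap (Measurable.aemeasurable (by fun_prop))
    _ = ∫⁻ y, ENNReal.ofReal B * (ENNReal.ofReal ((4 * Real.pi * σ ^ 2) ^ ((d : ℝ) / 2)) *
          ENNReal.ofReal (Real.exp (‖y - m‖ ^ 2 / (4 * S ^ 2)))) ∂μ := by
        congr 1; ext y
        rw [lintegral_const_mul _ (by fun_prop), lintegral_mul_const _ (by fun_prop),
          lintegral_sub_right_eq_self (fun z : EuclideanSpace ℝ (Fin d) =>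
            ENNReal.ofReal (Real.exp (-(1 / (4 * σ ^ 2)) * ‖z‖ ^ 2))) y,
          lintegral_exp_neg_mul_sq_norm (by positivity)]
        congr 5; field_simp
    _ ≤ ENNReal.ofReal B * (ENNReal.ofReal ((4 * Real.pi * σ ^ 2) ^ ((d : ℝ) / 2)) *
          ENNReal.ofReal (2 ^ ((d : ℝ) / 2))) := by
        rw [lintegral_const_mul _ (by fun_prop), lintegral_const_mul _ (by fun_prop)]
        gcongr
        exact hμ.lintegral_exp_sq_norm_le hS0 (by gcongr; linarith)
    _ = _ := by
        rw [← ENNReal.ofReal_mul (by positivity), ← ENNReal.ofReal_mul hB, ← mul_assoc B]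

/-- The parametric rate for a noise density with Gaussian tails. -/
lemma lintegral_smoothW1_empirical_le_of_gaussian_tail
    {f : EuclideanSpace ℝ (Fin d) → ℝ} (hf : Measurable f) (hf0 : ∀ t, 0 ≤ f t)
    {σ K B : ℝ} (hσ : 0 < σ) (hK : 0 < K) (hB : 0 ≤ B)
    (hfB : ∀ t, f t ^ 2 ≤ B * Real.exp (-‖t‖ ^ 2 / (2 * σ ^ 2)))
    (hG : IsProbabilityMeasure
      ((volume : Measure (EuclideanSpace ℝ (Fin d))).withDensity fun t => ENNReal.ofReal (f t)))
    {μ : Measure (EuclideanSpace ℝ (Fin d))} (hμ : IsSubgaussian K μ) {n : ℕ} (hn : 1 ≤ n) :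
    ∫⁻ x : Fin n → EuclideanSpace ℝ (Fin d),
        smoothW1 (volume.withDensity fun t => ENNReal.ofReal (f t)) (empirical x) μ
        ∂(Measure.pi fun _ => μ) ≤
      ENNReal.ofReal ((n : ℝ) ^ (-(1 / 2 : ℝ)) *
        √(16 * (K + σ) ^ 2 * (16 * Real.pi * (K + σ) ^ 2) ^ ((d : ℝ) / 2) *
          (B * (4 * Real.pi * σ ^ 2) ^ ((d : ℝ) / 2) * 2 ^ ((d : ℝ) / 2)))) := by
  have := hμ.isProbabilityMeasure
  have hfC (t : EuclideanSpace ℝ (Fin d)) : f t ≤ √B := by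
    apply Real.le_sqrt_of_sq_le
    refine (hfB t).trans (mul_le_of_le_one_right hB (Real.exp_le_one_iff.2 ?_))
    rw [neg_div]; exact neg_nonpos.2 (by positivity)
  set m := ∫ x, x ∂μ with hm
  have ha : 0 < 1 / (8 * (K + σ) ^ 2) := by positivity
  refine (lintegral_smoothW1_empirical_le hf hf0 hfC hG m hn).trans ?_
  rw [ENNReal.ofReal_mul (by positivity)]
  gcongr
  have h2 : Measurable fun z => ∫ y, f (z - y) ^ 2 ∂μ :=
    (StronglyMeasurable.integral_prod_right'
      (f := fun p : EuclideanSpace ℝ (Fin d) × EuclideanSpace ℝ (Fin d) => f (p.1 - p.2) ^ 2)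
      (Measurable.stronglyMeasurable (by fun_prop))).measurable
  -- A Gaussian weight and its inverse are inserted before Cauchy–Schwarz, one on each factor.
  calc ∫⁻ z, edist z m * ENNReal.ofReal √(∫ y, f (z - y) ^ 2 ∂μ)
      = ∫⁻ z, (edist z m *
            ENNReal.ofReal (Real.exp (-(1 / (8 * (K + σ) ^ 2) / 2) * ‖z - m‖ ^ 2))) *
          (ENNReal.ofReal (Real.exp (1 / (8 * (K + σ) ^ 2) / 2 * ‖z - m‖ ^ 2)) *
            ENNReal.ofReal √(∫ y, f (z - y) ^ 2 ∂μ)) := by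
        congr 1; ext z
        rw [mul_mul_mul_comm, mul_assoc, ← mul_assoc (ENNReal.ofReal _),
          ← ENNReal.ofReal_mul (Real.exp_pos _).le, ← Real.exp_add]
        simp
    _ ≤ _ := by
        refine lintegral_mul_le_sqrt_mul (by fun_prop) (by fun_prop) (by positivity)
          (by positivity) ?_
          (lintegral_exp_mul_second_moment_le hf hσ hK hB
            (fun t => (abs_of_nonneg (hf0 t)).trans_le (hfC t)) hfB hμ)
        refine (lintegral_sq_edist_mul_exp_le ha m).trans (le_of_eq ?_)
        congr 2
        · field_simp; norm_num
        · congr 1; field_simp; norm_num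

end Core
-- Gaussian bound for a unimodal subgaussian density
section NoiseDensity

lemma IsSubgaussian.map_neg {E : Type*} [NormedAddCommGroup E] [InnerProductSpace ℝ E]
    [MeasurableSpace E] [BorelSpace E] {K : ℝ} {μ : Measure E} (h : IsSubgaussian K μ) :
    IsSubgaussian K (μ.map Neg.neg) := by
  have hemb : MeasurableEmbedding (Neg.neg : E → E) := (MeasurableEquiv.neg E).measurableEmbedding
  have hm : ∫ y, y ∂(μ.map Neg.neg) = -∫ y, y ∂μ := by
    rw [hemb.integral_map, integral_neg]
  have hfun (a : E) : (fun x : E => Real.exp (inner ℝ a (-x - ∫ y, y ∂(μ.map Neg.neg)))) =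
      fun x => Real.exp (inner ℝ (-a) (x - ∫ y, y ∂μ)) := by
    ext x
    rw [hm, inner_neg_left, ← inner_neg_right]
    congr 2; abel
  have := h.isProbabilityMeasure
  refine ⟨Measure.isProbabilityMeasure_map (by fun_prop), ?_, fun a => ?_, fun a => ?_⟩
  · rw [hemb.integrable_map_iff]; exact h.integrable_id.neg
  · rw [hemb.integrable_map_iff]
    have := h.integrable_exp (-a)
    rwa [← hfun] at this
  · rw [hemb.integral_map, hfun]
    simpa using h.integral_exp_le (-a)

variable {σ M : ℝ} {g : ℝ → ℝ}

/-- Reflection reduces the left tail to the right one. -/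
lemma IsNoiseDensity.comp_neg (h : IsNoiseDensity σ M g) :
    IsNoiseDensity σ M fun t => g (-t) := by
  refine ⟨fun t => h.nonneg _, ?_, fun t => h.le_bound _, ?_, ?_⟩
  · have hemb : MeasurableEmbedding (Neg.neg : ℝ → ℝ) := (MeasurableEquiv.neg ℝ).measurableEmbedding
    have hmap : ((volume : Measure ℝ).withDensity fun t => ENNReal.ofReal (g t)).map Neg.neg =
        (volume : Measure ℝ).withDensity fun t => ENNReal.ofReal (g (-t)) := by
      ext s hs
      rw [hemb.map_apply, withDensity_apply _ (hemb.measurable hs), withDensity_apply _ hs]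
      have := (Measure.measurePreserving_neg (volume : Measure ℝ)).setLIntegral_comp_preimage_emb
        hemb (fun t => ENNReal.ofReal (g (-t))) s
      simpa using this
    rw [← hmap]
    exact h.subgaussian.map_neg
  · intro x hx y hy hxy
    exact h.monotoneOn (by simpa using hy) (by simpa using hx) (by linarith)
  · intro x hx y hy hxy
    exact h.antitoneOn (by simpa using hy) (by simpa using hx) (by linarith)

/-- Measurability is not part of the definition; it follows from monotonicity on each half-line. -/
lemma IsNoiseDensity.measurable (h : IsNoiseDensity σ M g) : Measurable g := by
  have h1 : Antitone fun t => g (max t 0) := fun x y hxy =>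
    h.antitoneOn (by simp) (by simp) (max_le_max_right 0 hxy)
  have h2 : Monotone fun t => g (min t 0) := fun x y hxy =>
    h.monotoneOn (by simp) (by simp) (min_le_min_right 0 hxy)
  have h3 : g = fun t => if 0 ≤ t then g (max t 0) else g (min t 0) := by
    ext t
    split_ifs with ht
    · rw [max_eq_left ht]
    · rw [min_eq_left (not_le.1 ht).le]
  rw [h3]
  exact Measurable.ite measurableSet_Ici h1.measurable h2.measurable

/-- Chernoff's bound. -/
lemma IsSubgaussian.measure_le {ν : Measure ℝ} (h : IsSubgaussian σ ν) (a r : ℝ) :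
    ν {x | r ≤ a * (x - ∫ y, y ∂ν)} ≤ ENNReal.ofReal (Real.exp (σ ^ 2 * a ^ 2 / 2 - r)) := by
  set m := ∫ y, y ∂ν
  have h1 : ∫⁻ x, ENNReal.ofReal (Real.exp (a * (x - m) - r)) ∂ν ≤
      ENNReal.ofReal (Real.exp (σ ^ 2 * a ^ 2 / 2 - r)) := by
    have hi := h.integrable_exp a
    have hl := h.integral_exp_le a
    simp only [RCLike.inner_apply, conj_trivial, Real.norm_eq_abs, sq_abs] at hi hl
    simp only [sub_eq_add_neg _ r, Real.exp_add, mul_comm a]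
    rw [← ofReal_integral_eq_lintegral_ofReal (hi.mul_const _)
      (ae_of_all _ fun _ => by positivity), integral_mul_const]
    apply ENNReal.ofReal_le_ofReal
    gcongr
  refine le_trans ?_ h1
  have hs : MeasurableSet {x | r ≤ a * (x - m)} := measurableSet_le (by fun_prop) (by fun_prop)
  rw [← lintegral_indicator_one hs]
  refine lintegral_mono (Set.indicator_le fun x hx => ?_)
  simp only [Pi.one_apply, ENNReal.one_le_ofReal, Real.one_le_exp_iff]
  exact sub_nonneg.2 hx

/-- If the mean were 2r with r > 3σ, concentration would put most of the mass in (r, 3r]. But g is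
non-increasing on [0, ∞), so that interval has at most twice the mass of (0, r], which lies in the
lower tail. The total mass would then be at most 4/5. -/
lemma IsNoiseDensity.integral_le (h : IsNoiseDensity σ M g) (hσ : 0 < σ) :
    ∫ y, y ∂((volume : Measure ℝ).withDensity fun t => ENNReal.ofReal (g t)) ≤ 6 * σ := by
  set ν := (volume : Measure ℝ).withDensity fun t => ENNReal.ofReal (g t) with hν
  have hsub : IsSubgaussian σ ν := h.subgaussian
  have := hsub.isProbabilityMeasure
  set m := ∫ y, y ∂ν with hm
  by_contra! hlt
  obtain ⟨r, hr⟩ : ∃ r, m = 2 * r := ⟨m / 2, by ring⟩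
  have hr3 : 3 * σ < r := by linarith
  have hr0 : 0 < r := by linarith
  have htail (s : Set ℝ) (a : ℝ) (ha : a ^ 2 = (r / σ ^ 2) ^ 2)
      (hs : ∀ x ∈ s, r ^ 2 / σ ^ 2 ≤ a * (x - m)) : ν s ≤ ENNReal.ofReal (1 / 5) := by
    refine (measure_mono hs).trans ((hsub.measure_le a _).trans (ENNReal.ofReal_le_ofReal ?_))
    rw [ha]
    have h1 : σ ^ 2 * (r / σ ^ 2) ^ 2 / 2 - r ^ 2 / σ ^ 2 = -((r / σ) ^ 2 / 2) := by
      field_simp; ring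
    -- Since r > 3σ, the tail is below e^{-9/2}, and 1 + x ≤ eˣ gives e^{9/2} ≥ 11/2 > 5.
    rw [h1, Real.exp_neg, one_div]
    have h2 : 3 < r / σ := by rwa [lt_div_iff₀ hσ]
    have h3 := Real.add_one_le_exp ((r / σ) ^ 2 / 2)
    gcongr
    nlinarith
  have hlow : ν (Set.Iic r) ≤ ENNReal.ofReal (1 / 5) := by
    refine htail _ (-(r / σ ^ 2)) (by ring) fun x hx => ?_
    have : r ^ 2 / σ ^ 2 = r / σ ^ 2 * r := by ring
    rw [this, neg_mul, ← mul_neg]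
    gcongr
    have : x ≤ r := hx
    linarith
  have hhigh : ν (Set.Ioi (3 * r)) ≤ ENNReal.ofReal (1 / 5) := by
    refine htail _ (r / σ ^ 2) rfl fun x hx => ?_
    have : r ^ 2 / σ ^ 2 = r / σ ^ 2 * r := by ring
    rw [this]
    gcongr
    have : 3 * r < x := hx
    linarith
  have hmid : ν (Set.Ioc r (3 * r)) ≤ 2 * ν (Set.Iic r) := by
    calc ν (Set.Ioc r (3 * r)) = ∫⁻ t in Set.Ioc r (3 * r), ENNReal.ofReal (g t) := by
          rw [hν, withDensity_apply _ measurableSet_Ioc]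
      _ ≤ ∫⁻ t in Set.Ioc r (3 * r), ENNReal.ofReal (g r) := by
          refine setLIntegral_mono (by fun_prop) fun t ht => ENNReal.ofReal_le_ofReal ?_
          exact h.antitoneOn hr0.le (hr0.le.trans ht.1.le) ht.1.le
      _ = 2 * ∫⁻ t in Set.Ioc 0 r, ENNReal.ofReal (g r) := by
          simp only [setLIntegral_const, Real.volume_Ioc]
          have h2r : ENNReal.ofReal (3 * r - r) = 2 * ENNReal.ofReal r := by
            rw [← ENNReal.ofReal_ofNat, ← ENNReal.ofReal_mul (by norm_num)]
            congr 1; ring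
          rw [h2r, sub_zero, mul_left_comm]
      _ ≤ 2 * ∫⁻ t in Set.Ioc 0 r, ENNReal.ofReal (g t) := by
          gcongr 2 * ?_
          refine setLIntegral_mono h.measurable.ennreal_ofReal
            fun t ht => ENNReal.ofReal_le_ofReal ?_
          exact h.antitoneOn ht.1.le hr0.le ht.2
      _ = 2 * ν (Set.Ioc 0 r) := by rw [hν, withDensity_apply _ measurableSet_Ioc]
      _ ≤ 2 * ν (Set.Iic r) := by gcongr; exact Set.Ioc_subset_Iic_self
  have hcover : (Set.univ : Set ℝ) ⊆ Set.Iic r ∪ Set.Ioc r (3 * r) ∪ Set.Ioi (3 * r) := by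
    intro x _
    by_cases h1 : x ≤ r
    · exact Or.inl (Or.inl h1)
    · by_cases h2 : x ≤ 3 * r
      · exact Or.inl (Or.inr ⟨not_le.1 h1, h2⟩)
      · exact Or.inr (not_le.1 h2)
  have htot : (1 : ℝ≥0∞) ≤ ENNReal.ofReal (4 / 5) := by
    calc (1 : ℝ≥0∞) = ν Set.univ := measure_univ.symm
      _ ≤ ν (Set.Iic r) + ν (Set.Ioc r (3 * r)) + ν (Set.Ioi (3 * r)) :=
          (measure_mono hcover).trans
            ((measure_union_le _ _).trans (add_le_add_left (measure_union_le _ _) _))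
      _ ≤ ENNReal.ofReal (1 / 5) + 2 * ENNReal.ofReal (1 / 5) + ENNReal.ofReal (1 / 5) := by
          gcongr
          exact hmid.trans (by gcongr)
      _ = ENNReal.ofReal (4 / 5) := by
          rw [← ENNReal.ofReal_ofNat, ← ENNReal.ofReal_mul (by norm_num),
            ← ENNReal.ofReal_add (by norm_num) (by norm_num),
            ← ENNReal.ofReal_add (by norm_num) (by norm_num)]
          norm_num
  rw [ENNReal.one_le_ofReal] at htot
  norm_num at htot

/-- For t ≥ 1 the interval (t - 1, t] lies in [0, ∞), so by monotonicity its mass is at least g(t).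
Chernoff's bound with slope t/σ² yields the sharp quadratic term; the shift by 1 and the mean only
contribute a term linear in t. -/
lemma IsNoiseDensity.le_exp_of_one_le (h : IsNoiseDensity σ M g) (hσ : 0 < σ) {t : ℝ}
    (ht : 1 ≤ t) : g t ≤ Real.exp (t * ((1 + 6 * σ) / σ ^ 2) - t ^ 2 / (2 * σ ^ 2)) := by
  set ν := (volume : Measure ℝ).withDensity fun t => ENNReal.ofReal (g t) with hν
  have hm : ∫ y, y ∂ν ≤ 6 * σ := h.integral_le hσ
  set m := ∫ y, y ∂ν with hm'
  rw [← ENNReal.ofReal_le_ofReal_iff (Real.exp_pos _).le]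
  calc ENNReal.ofReal (g t) = ∫⁻ s in Set.Ioc (t - 1) t, ENNReal.ofReal (g t) := by simp
    _ ≤ ∫⁻ s in Set.Ioc (t - 1) t, ENNReal.ofReal (g s) := by
        refine setLIntegral_mono h.measurable.ennreal_ofReal
          fun s hs => ENNReal.ofReal_le_ofReal ?_
        have h0 : 0 ≤ s := by linarith [hs.1]
        exact h.antitoneOn h0 (h0.trans hs.2) hs.2
    _ = ν (Set.Ioc (t - 1) t) := by rw [hν, withDensity_apply _ measurableSet_Ioc]
    _ ≤ ν {x | t / σ ^ 2 * (t - 1 - m) ≤ t / σ ^ 2 * (x - m)} := by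
        refine measure_mono fun x hx => ?_
        change t / σ ^ 2 * (t - 1 - m) ≤ t / σ ^ 2 * (x - m)
        gcongr
        exact hx.1.le
    _ ≤ ENNReal.ofReal (Real.exp (σ ^ 2 * (t / σ ^ 2) ^ 2 / 2 - t / σ ^ 2 * (t - 1 - m))) :=
        h.subgaussian.measure_le _ _
    _ ≤ _ := by
        refine ENNReal.ofReal_le_ofReal (Real.exp_le_exp.2 ?_)
        calc σ ^ 2 * (t / σ ^ 2) ^ 2 / 2 - t / σ ^ 2 * (t - 1 - m)
            = t * ((1 + m) / σ ^ 2) - t ^ 2 / (2 * σ ^ 2) := by field_simp; ring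
          _ ≤ _ := by gcongr

/-- The constant in the Gaussian bound of a noise density. -/
noncomputable def tailConst (σ M δ : ℝ) : ℝ :=
  |M| * Real.exp (1 / (2 * σ ^ 2)) + Real.exp (((1 + 6 * σ) / σ ^ 2) ^ 2 / (4 * δ))

lemma tailConst_pos (σ M δ : ℝ) : 0 < tailConst σ M δ := by
  unfold tailConst; positivity

/-- The two summands of `tailConst` serve two ranges. On [0, 1] the bound M suffices, because the
Gaussian factor is at least exp(-1/(2σ²)). For t ≥ 1 the linear term is absorbed by tb ≤ b²/(4δ) +
δt². -/
lemma IsNoiseDensity.le_of_nonneg (h : IsNoiseDensity σ M g) (hσ : 0 < σ) {δ : ℝ} (hδ : 0 < δ)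
    {t : ℝ} (ht : 0 ≤ t) :
    g t ≤ tailConst σ M δ * Real.exp (δ * t ^ 2 - t ^ 2 / (2 * σ ^ 2)) := by
  unfold tailConst
  rw [add_mul]
  rcases le_total 1 t with h1 | h1
  · refine le_add_of_nonneg_of_le (by positivity) ((h.le_exp_of_one_le hσ h1).trans ?_)
    rw [← Real.exp_add]
    gcongr
    set b := (1 + 6 * σ) / σ ^ 2
    have h2 : t * b ≤ b ^ 2 / (4 * δ) + δ * t ^ 2 := by
      have h3 : b ^ 2 / (4 * δ) + δ * t ^ 2 - t * b = (b - 2 * δ * t) ^ 2 / (4 * δ) := by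
        field_simp; ring
      have h4 : 0 ≤ (b - 2 * δ * t) ^ 2 / (4 * δ) := by positivity
      linarith
    linarith
  · refine le_add_of_le_of_nonneg ?_ (by positivity)
    rw [mul_assoc, ← Real.exp_add]
    refine ((h.le_bound t).trans (le_abs_self M)).trans
      (le_mul_of_one_le_right (abs_nonneg M) (Real.one_le_exp ?_))
    have h2 : t ^ 2 / (2 * σ ^ 2) ≤ 1 / (2 * σ ^ 2) := by
      gcongr; exact pow_le_one₀ ht h1
    have h3 : 0 ≤ δ * t ^ 2 := by positivity
    linarith

lemma IsNoiseDensity.le_mul_exp (h : IsNoiseDensity σ M g) (hσ : 0 < σ) {δ : ℝ} (hδ : 0 < δ)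
    (t : ℝ) : g t ≤ tailConst σ M δ * Real.exp (δ * t ^ 2 - t ^ 2 / (2 * σ ^ 2)) := by
  rcases le_total 0 t with ht | ht
  · exact h.le_of_nonneg hσ hδ ht
  · simpa using h.comp_neg.le_of_nonneg hσ hδ (neg_nonneg.2 ht)

lemma IsNoiseDensity.prodDensity_le (h : IsNoiseDensity σ M g) (hσ : 0 < σ) {δ : ℝ} (hδ : 0 < δ)
    {d : ℕ} (t : EuclideanSpace ℝ (Fin d)) :
    prodDensity d g t ≤
      (tailConst σ M δ * √(2 * Real.pi * σ ^ 2)) ^ d * Real.exp (δ * ‖t‖ ^ 2) *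
        gaussianDensity d σ t := by
  have hpos : 0 < 2 * Real.pi * σ ^ 2 := by positivity
  -- The normalisation of the Gaussian density is inserted as 1, at the price of √(2πσ²) per
  -- coordinate in the constant.
  have hsq : √(2 * Real.pi * σ ^ 2) ^ d * (2 * Real.pi * σ ^ 2) ^ (-(d : ℝ) / 2) = 1 := by
    rw [Real.sqrt_eq_rpow, ← Real.rpow_natCast, ← Real.rpow_mul hpos.le, ← Real.rpow_add hpos]
    ring_nf
    simp
  calc prodDensity d g t
      ≤ ∏ j, (tailConst σ M δ * Real.exp (δ * t j ^ 2 - t j ^ 2 / (2 * σ ^ 2))) :=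
        Finset.prod_le_prod (fun j _ => h.nonneg _) fun j _ => h.le_mul_exp hσ hδ _
    _ = tailConst σ M δ ^ d * Real.exp (δ * ‖t‖ ^ 2 + -‖t‖ ^ 2 / (2 * σ ^ 2)) := by
        rw [Finset.prod_mul_distrib, ← Real.exp_sum, EuclideanSpace.real_norm_sq_eq]
        simp only [Finset.prod_const, Finset.card_univ, Fintype.card_fin, Finset.sum_sub_distrib,
          ← Finset.mul_sum, ← Finset.sum_div]
        congr 2; ring
    _ = tailConst σ M δ ^ d * Real.exp (δ * ‖t‖ ^ 2 + -‖t‖ ^ 2 / (2 * σ ^ 2)) *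
          (√(2 * Real.pi * σ ^ 2) ^ d * (2 * Real.pi * σ ^ 2) ^ (-(d : ℝ) / 2)) := by
        rw [hsq, mul_one]
    _ = _ := by
        rw [gaussianDensity, mul_pow, Real.exp_add]; ring

end NoiseDensity

/-! ### The product noise as a probability measure -/

section Product

variable {g : ℝ → ℝ} {d : ℕ}

lemma measurable_prodDensity (hg : Measurable g) : Measurable (prodDensity d g) := by
  unfold prodDensity
  fun_prop

lemma pi_withDensity_ofReal (hg0 : ∀ t, 0 ≤ g t) (hi : Integrable g) :
    Measure.pi (fun _ : Fin d => (volume : Measure ℝ).withDensity fun t => ENNReal.ofReal (g t)) =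
      (volume : Measure (Fin d → ℝ)).withDensity fun x => ENNReal.ofReal (∏ j, g (x j)) := by
  have : SigmaFinite ((volume : Measure ℝ).withDensity fun t => ENNReal.ofReal (g t)) :=
    SigmaFinite.withDensity_ofReal g
  refine Measure.pi_eq fun s hs => ?_
  rw [withDensity_apply _ (.univ_pi hs), volume_pi, Measure.restrict_pi_pi,
    ← ofReal_integral_eq_lintegral_ofReal, integral_fintype_prod_eq_prod (fun _ => g),
    ENNReal.ofReal_prod_of_nonneg fun i _ => integral_nonneg hg0]
  · refine Finset.prod_congr rfl fun i _ => ?_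
    rw [withDensity_apply _ (hs i), ofReal_integral_eq_lintegral_ofReal hi.restrict
      (ae_of_all _ hg0)]
  · exact Integrable.fintype_prod fun i => hi.restrict
  · exact ae_of_all _ fun x => Finset.prod_nonneg fun i _ => hg0 _

/-- The noise distribution is the law of a vector with independent coordinates. -/
lemma noise_eq_map_pi (hg : Measurable g) (hg0 : ∀ t, 0 ≤ g t) (hi : Integrable g) :
    noise d g = (Measure.pi fun _ : Fin d =>
      (volume : Measure ℝ).withDensity fun t => ENNReal.ofReal (g t)).map (WithLp.toLp 2) := by
  refine Measure.ext_of_lintegral _ fun f hf => ?_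
  have hd : Measurable fun x : EuclideanSpace ℝ (Fin d) => ENNReal.ofReal (prodDensity d g x) :=
    (measurable_prodDensity hg).ennreal_ofReal
  rw [pi_withDensity_ofReal hg0 hi, lintegral_map hf (by fun_prop), noise,
    lintegral_withDensity_eq_lintegral_mul _ hd hf,
    lintegral_withDensity_eq_lintegral_mul _ (by fun_prop) (by fun_prop),
    ← (PiLp.volume_preserving_toLp (Fin d)).lintegral_comp (hd.mul hf)]
  rfl

lemma IsNoiseDensity.integrable {σ M : ℝ} (h : IsNoiseDensity σ M g) : Integrable g := by
  have := h.subgaussian.isProbabilityMeasure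
  have h1 : ∫⁻ t, ENNReal.ofReal (g t) = 1 := by
    rw [← Measure.restrict_univ (μ := (volume : Measure ℝ)), ← withDensity_apply _ .univ,
      measure_univ]
  exact (lintegral_ofReal_ne_top_iff_integrable h.measurable.aestronglyMeasurable
    (ae_of_all _ h.nonneg)).1 (h1 ▸ ENNReal.one_ne_top)

lemma IsNoiseDensity.isProbabilityMeasure_noise {σ M : ℝ} (h : IsNoiseDensity σ M g) (d : ℕ) :
    IsProbabilityMeasure (noise d g) := by
  have := h.subgaussian.isProbabilityMeasure
  rw [noise_eq_map_pi h.measurable h.nonneg h.integrable]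
  exact Measure.isProbabilityMeasure_map (by fun_prop)

end Product

/-! ### Gaussian noise as an instance of product noise -/

section Gaussian

/-- Both characteristic functions equal exp(-σ²‖t‖²/2), the second as a product over coordinates. -/
lemma isoGaussian_eq_map_pi (d : ℕ) {σ : ℝ} {v : NNReal} (hv : (v : ℝ) = σ ^ 2) :
    isoGaussian d σ = (Measure.pi fun _ : Fin d => gaussianReal 0 v).map (WithLp.toLp 2) := by
  have := Measure.isProbabilityMeasure_map (μ := Measure.pi fun _ : Fin d => gaussianReal 0 v)
    (f := WithLp.toLp 2) (by fun_prop)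
  have : IsProbabilityMeasure (isoGaussian d σ) := by unfold isoGaussian; infer_instance
  refine Measure.ext_of_charFun ?_
  ext t
  have hS : (σ ^ 2 • (1 : Matrix (Fin d) (Fin d) ℝ)).PosSemidef :=
    Matrix.PosSemidef.one.smul (sq_nonneg σ)
  rw [isoGaussian, charFun_multivariateGaussian hS]
  simp_rw [charFun_pi, charFun_gaussianReal, ← Complex.exp_sum]
  congr 1
  have hv' : (v : ℂ) = (σ : ℂ) ^ 2 := by exact_mod_cast congrArg (fun x : ℝ => (x : ℂ)) hv
  simp [dotProduct, Matrix.smul_mulVec, hv', Finset.sum_div]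
  exact Finset.sum_congr rfl fun i _ => by ring

lemma isNoiseDensity_gaussianPDFReal {σ : ℝ} {v : NNReal} (hσ : 0 < σ)
    (hv : (v : ℝ) = σ ^ 2) :
    IsNoiseDensity σ (√(2 * Real.pi * v))⁻¹ (gaussianPDFReal 0 v) := by
  have hv0 : v ≠ 0 := fun h => (pow_pos hσ 2).ne' (by rw [← hv, h]; rfl)
  have hG : ((volume : Measure ℝ).withDensity fun t => ENNReal.ofReal (gaussianPDFReal 0 v t)) =
      gaussianReal 0 v := (gaussianReal_of_var_ne_zero 0 hv0).symm
  refine ⟨gaussianPDFReal_nonneg 0 v, ?_, fun t => ?_, ?_, ?_⟩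
  · rw [hG]
    refine ⟨inferInstance, IsGaussian.integrable_id, fun a => ?_, fun a => ?_⟩
    · simpa [mul_comm] using integrable_exp_mul_gaussianReal a
    · have := congrFun (mgf_fun_id_gaussianReal (μ := 0) (v := v)) a
      simp only [mgf, zero_mul, zero_add, hv] at this
      simp [mul_comm _ a, this]
  · refine mul_le_of_le_one_right (by positivity) (Real.exp_le_one_iff.2 ?_)
    rw [neg_div]; exact neg_nonpos.2 (by positivity)
  · intro x hx y hy hxy
    simp only [gaussianPDFReal, sub_zero]
    have : 0 ≤ x := hx
    gcongr
  · intro x hx y hy hxy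
    simp only [gaussianPDFReal, sub_zero]
    have hy' : y ≤ 0 := hy
    gcongr 3
    nlinarith

lemma noise_gaussianPDFReal (d : ℕ) {σ : ℝ} {v : NNReal} (hσ : 0 < σ) (hv : (v : ℝ) = σ ^ 2) :
    noise d (gaussianPDFReal 0 v) = isoGaussian d σ := by
  have hv0 : v ≠ 0 := fun h => (pow_pos hσ 2).ne' (by rw [← hv, h]; rfl)
  rw [isoGaussian_eq_map_pi d hv, noise_eq_map_pi (measurable_gaussianPDFReal 0 v)
    (gaussianPDFReal_nonneg 0 v) (integrable_gaussianPDFReal 0 v), gaussianReal_of_var_ne_zero 0 hv0]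
  rfl

end Gaussian
-- Bookkeeping of the constants
section Rate

/-- With s = 1 + K/σ, the powers of 2πσ² cancel and the radicand is 16 · 32^{d/2} c^{2d} σ² s^{d+2}.
For d ≥ 1 both 16 and 32^{d/2} are at most 16^d, which gives (16c)^d after the root. The factors
√(2d) and e^{3d/16} are at least 1 and pure slack. -/
lemma sqrt_le_rateConst {c σ K : ℝ} {d : ℕ} (hc : 0 < c) (hσ : 0 < σ) (hK : 0 < K) (hd : 1 ≤ d) :
    √(16 * (K + σ) ^ 2 * (16 * Real.pi * (K + σ) ^ 2) ^ ((d : ℝ) / 2) *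
        ((c ^ d * (2 * Real.pi * σ ^ 2) ^ (-(d : ℝ) / 2)) ^ 2 *
          (4 * Real.pi * σ ^ 2) ^ ((d : ℝ) / 2) * 2 ^ ((d : ℝ) / 2))) ≤
      rateConst (16 * c) σ d K := by
  have hd' : (1 : ℝ) ≤ d := by exact_mod_cast hd
  obtain ⟨s, hs0, hs⟩ : ∃ s : ℝ, 0 < s ∧ K + σ = σ * s :=
    ⟨1 + K / σ, by positivity, by field_simp; ring⟩
  have hs' : 1 + K / σ = s := by
    field_simp; linarith
  have hπ := Real.pi_pos
  set D := (2 * Real.pi * σ ^ 2) ^ ((d : ℝ) / 2) with hD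
  set q := s ^ ((d : ℝ) / 2) with hq
  have hD0 : 0 < D := by positivity
  have hq0 : 0 < q := by positivity
  have e1 : (2 * Real.pi * σ ^ 2) ^ (-(d : ℝ) / 2) = D⁻¹ := by
    rw [hD, neg_div, Real.rpow_neg (by positivity)]
  have e2 : (4 * Real.pi * σ ^ 2) ^ ((d : ℝ) / 2) = 2 ^ ((d : ℝ) / 2) * D := by
    rw [hD, ← Real.mul_rpow (by positivity) (by positivity)]; congr 1; ring
  have e3 : (16 * Real.pi * (K + σ) ^ 2) ^ ((d : ℝ) / 2) = 8 ^ ((d : ℝ) / 2) * D * (q * q) := by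
    rw [hD, hq, ← Real.mul_rpow (by positivity) (by positivity),
      ← Real.mul_rpow (by positivity) (by positivity),
      ← Real.mul_rpow (by positivity) (by positivity), hs]
    congr 1; ring
  have e4 : (8 : ℝ) ^ ((d : ℝ) / 2) * 2 ^ ((d : ℝ) / 2) * 2 ^ ((d : ℝ) / 2) ≤ 16 ^ d := by
    rw [← Real.mul_rpow (by positivity) (by positivity),
      ← Real.mul_rpow (by positivity) (by positivity), ← Real.rpow_natCast]
    calc ((8 : ℝ) * 2 * 2) ^ ((d : ℝ) / 2) ≤ (16 ^ (2 : ℝ)) ^ ((d : ℝ) / 2) := by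
          gcongr; norm_num
      _ = 16 ^ (d : ℝ) := by
          rw [← Real.rpow_mul (by positivity)]; congr 1; ring
  have e5 : s ^ ((d : ℝ) / 2 + 1) = q * s := by
    rw [hq, Real.rpow_add hs0, Real.rpow_one]
  have e6 : (16 : ℝ) ≤ 16 ^ d := le_self_pow₀ (by norm_num) (by omega)
  have e7 : (1 : ℝ) ≤ √(2 * d) := Real.one_le_sqrt.2 (by linarith)
  have e8 : 1 ≤ Real.exp (3 * d / 16) := Real.one_le_exp (by positivity)
  rw [rateConst, hs', e1, e2, e3, e5, hs]
  calc _ ≤ √(((16 * c) ^ d * σ * (q * s)) ^ 2) := by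
        apply Real.sqrt_le_sqrt
        calc _ = 16 * (8 ^ ((d : ℝ) / 2) * 2 ^ ((d : ℝ) / 2) * 2 ^ ((d : ℝ) / 2)) *
              ((c ^ d) ^ 2 * σ ^ 2 * (q * s) ^ 2) := by field_simp
          _ ≤ 16 ^ d * 16 ^ d * ((c ^ d) ^ 2 * σ ^ 2 * (q * s) ^ 2) := by gcongr
          _ = _ := by rw [mul_pow 16 c d]; ring
    _ = (16 * c) ^ d * σ * 1 * (q * s) * 1 := by
        rw [Real.sqrt_sq (by positivity)]; ring
    _ ≤ _ := by gcongr

lemma gaussianDensity_nonneg (d : ℕ) (σ : ℝ) (x : EuclideanSpace ℝ (Fin d)) :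
    0 ≤ gaussianDensity d σ x := by
  unfold gaussianDensity; positivity

/-- The restriction on δ leaves at least half of the Gaussian exponent, and squaring restores the
full one. -/
lemma prodDensity_sq_le {g : ℝ → ℝ} (hg0 : ∀ t, 0 ≤ g t) {c σ δ : ℝ} (hc : 0 < c)
    (hσ : 0 < σ) (hδ : δ ≤ 1 / (4 * σ ^ 2)) {d : ℕ}
    (t : EuclideanSpace ℝ (Fin d))
    (h : prodDensity d g t ≤ c ^ d * Real.exp (δ * ‖t‖ ^ 2) * gaussianDensity d σ t) :
    prodDensity d g t ^ 2 ≤ (c ^ d * (2 * Real.pi * σ ^ 2) ^ (-(d : ℝ) / 2)) ^ 2 *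
      Real.exp (-‖t‖ ^ 2 / (2 * σ ^ 2)) := by
  have h0 : 0 ≤ prodDensity d g t := Finset.prod_nonneg fun j _ => hg0 _
  have h1 : prodDensity d g t ≤ c ^ d * (2 * Real.pi * σ ^ 2) ^ (-(d : ℝ) / 2) *
      Real.exp (-‖t‖ ^ 2 / (4 * σ ^ 2)) := by
    calc prodDensity d g t
        ≤ c ^ d * Real.exp (1 / (4 * σ ^ 2) * ‖t‖ ^ 2) * gaussianDensity d σ t := by
          refine h.trans (mul_le_mul_of_nonneg_right ?_ (gaussianDensity_nonneg d σ t))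
          gcongr
      _ = c ^ d * (2 * Real.pi * σ ^ 2) ^ (-(d : ℝ) / 2) *
          Real.exp (1 / (4 * σ ^ 2) * ‖t‖ ^ 2 + -‖t‖ ^ 2 / (2 * σ ^ 2)) := by
          rw [gaussianDensity, Real.exp_add]; ring
      _ = _ := by congr 2; field_simp; ring
  calc prodDensity d g t ^ 2 ≤ _ := pow_le_pow_left₀ h0 h1 2
    _ = _ := by
      rw [mul_pow, ← Real.exp_nat_mul]
      congr 2; push_cast; field_simp; ring

end Rate

end GOT

theorem theorem5 :
    -- general noise: the constant `c₁` depends only on `σ` and on the bound `M` of the factor `g`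
    (∀ σ M : ℝ, 0 < σ → ∃ c₁ : ℝ, 0 < c₁ ∧ ∀ g : ℝ → ℝ, GOT.IsNoiseDensity σ M g →
      (∀ (d : ℕ) (t : EuclideanSpace ℝ (Fin d)),
        GOT.prodDensity d g t ≤
          c₁ ^ d * Real.exp (min 1 (1 / (4 * σ ^ 2)) * ‖t‖ ^ 2) * GOT.gaussianDensity d σ t) ∧
      ∀ (d : ℕ) (K : ℝ) (μ : Measure (EuclideanSpace ℝ (Fin d))) (n : ℕ),
        1 ≤ d → 0 < K → GOT.IsSubgaussian K μ → 1 ≤ n →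
          AEMeasurable (fun x : Fin n → EuclideanSpace ℝ (Fin d) =>
            GOT.smoothW1 (GOT.noise d g) (GOT.empirical x) μ) (Measure.pi fun _ => μ) ∧
          ∫⁻ x : Fin n → EuclideanSpace ℝ (Fin d),
              GOT.smoothW1 (GOT.noise d g) (GOT.empirical x) μ ∂(Measure.pi fun _ => μ) ≤
            ENNReal.ofReal (GOT.rateConst c₁ σ d K * (n : ℝ) ^ (-(1 / 2 : ℝ)))) ∧
    -- Gaussian noise: the parametric rate in every dimension
    (∀ (d : ℕ) (σ K : ℝ), 1 ≤ d → 0 < σ → 0 < K →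
      ∃ C : ℝ, ∀ (μ : Measure (EuclideanSpace ℝ (Fin d))) (n : ℕ),
        GOT.IsSubgaussian K μ → 1 ≤ n →
          AEMeasurable (fun x : Fin n → EuclideanSpace ℝ (Fin d) =>
            GOT.smoothW1 (GOT.isoGaussian d σ) (GOT.empirical x) μ) (Measure.pi fun _ => μ) ∧
          ∫⁻ x : Fin n → EuclideanSpace ℝ (Fin d),
              GOT.smoothW1 (GOT.isoGaussian d σ) (GOT.empirical x) μ ∂(Measure.pi fun _ => μ) ≤
            ENNReal.ofReal (C * (n : ℝ) ^ (-(1 / 2 : ℝ)))) := by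
  -- The Gaussian statement is deduced from the general one, with M the peak value of the
  -- one-dimensional Gaussian density.
  refine (and_iff_left_of_imp fun general d σ K hd hσ hK => ?_).2 ?_
  · have hv : ((⟨σ ^ 2, sq_nonneg σ⟩ : NNReal) : ℝ) = σ ^ 2 := rfl
    obtain ⟨c, -, h⟩ := general σ _ hσ
    refine ⟨GOT.rateConst c σ d K, fun μ n hμ hn => ?_⟩
    rw [← GOT.noise_gaussianPDFReal d hσ hv]
    exact (h _ (GOT.isNoiseDensity_gaussianPDFReal hσ hv)).2 d K μ n hd hK hμ hn
  · intro σ M hσ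
    have hδ : 0 < min 1 (1 / (4 * σ ^ 2)) := lt_min one_pos (by positivity)
    set δ := min 1 (1 / (4 * σ ^ 2)) with hδ'
    set c := GOT.tailConst σ M δ * √(2 * Real.pi * σ ^ 2) with hc'
    have hc : 0 < c := mul_pos (GOT.tailConst_pos σ M δ) (by positivity)
    -- The pointwise bound already holds with `c`; the factor 16 is what `sqrt_le_rateConst` needs.
    refine ⟨16 * c, by positivity, fun g hg => ⟨fun d t => ?_, ?_⟩⟩
    · refine (hg.prodDensity_le hσ hδ t).trans ?_
      have hcc : c ≤ 16 * c := by linarith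
      exact mul_le_mul_of_nonneg_right (mul_le_mul_of_nonneg_right
        (pow_le_pow_left₀ hc.le hcc d) (Real.exp_pos _).le) (GOT.gaussianDensity_nonneg d σ t)
    · intro d K μ n hd hK hμ hn
      have hG := hg.isProbabilityMeasure_noise d
      have : NeZero n := ⟨by omega⟩
      refine ⟨(GOT.continuous_smoothW1_empirical _ _).measurable.aemeasurable, ?_⟩
      refine (GOT.lintegral_smoothW1_empirical_le_of_gaussian_tail
        (GOT.measurable_prodDensity hg.measurable)
        (fun t => Finset.prod_nonneg fun j _ => hg.nonneg _) hσ hK (sq_nonneg _)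
        (fun t => GOT.prodDensity_sq_le hg.nonneg hc hσ (min_le_right _ _) t
          (hg.prodDensity_le hσ hδ t)) hG hμ hn).trans ?_
      rw [mul_comm]
      gcongr
      exact GOT.sqrt_le_rateConst hc hσ hK hd
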